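/- Fix $\sigma>0$, $B>0$ and a cost $c>0$ per arm pull. A two-armed bandit model is a pair $\nu=(\nu_1,\nu_2)$ of probability distributions on $\mathbb{R}$ with means $\mu_1,\mu_2$. Let $\mathcal{M}$ be the set of models with $\mu_1,\mu_2\in[0,B]$ whose two arms are $\sigma$-sub-Gaussian, i.e. $\mathbb{P}_{X\sim\nu_a}(X-\mu_a>t)\le \exp(-t^2/(2\sigma^2))$ for all $t>0$, and for $\Delta>0$ let $\mathcal{M}_\Delta=\{\nu\in\mathcal{M}:|\mu_1-\mu_2|=\Delta\}$ be the models with gap $\Delta$ (either arm may be the better one). A (possibly randomised) policy $\pi$ decides in each round, from the past decisions and rewards, either to pull one of the two arms, observing an independent sample of its distribution, or to terminate and recommend an arm $\hat I\in\{1,2\}$; let $\tau\in\{0,1,\dots,\infty\}$ be the total number of pulls. Its risk in the model $\nu$ is $$R_2(\pi,\nu)=\mathbb{E}_{\nu,\pi}\big[\max(\mu_1,\mu_2)-\mu_{\hat I}+c\,\tau\big]\in[0,\infty].$$ (i) For every $\Delta$ with $0<\Delta\le B$ and every policy $\pi$, $$\sup_{\nu\in\mathcal{M}_\Delta}R_2(\pi,\nu)\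 \ge\ \begin{cases}\dfrac{\sigma^2c}{4\Delta^2}\log\!\Big(\dfrac{e\Delta^3}{\sigma^2c}\Big) & \text{if }\Delta\ge(\sigma^2c)^{1/3},\\[2mm] \dfrac{\Delta}{4} & \text{if }\Delta<(\sigma^2c)^{1/3}.\end{cases}$$ (ii) If $B\ge(\sqrt{e}\,\sigma^2c)^{1/3}$, then for every policy $\pi$, $$\sup_{\nu\in\mathcal{M}}R_2(\pi,\nu)\ \ge\ \frac38\Big(\frac{\sigma^2c}{e}\Big)^{1/3}.$$ -/

import Mathlib

open MeasureTheory ProbabilityTheory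
open scoped ENNReal

noncomputable section

namespace Bandit

/-- A two-armed bandit model: the reward distribution of each of the two arms. -/
abbrev Model := Fin 2 → ProbabilityMeasure ℝ

/-- Expected reward of arm `a`. -/
def Model.mean (ν : Model) (a : Fin 2) : ℝ := ∫ x, x ∂(ν a : Measure ℝ)

/-- The larger of the two expected rewards. -/
def Model.bestMean (ν : Model) : ℝ := max (ν.mean 0) (ν.mean 1)

/-- `σ`-sub-Gaussian distributions: the mean exists, and
`P (X - E X > t) ≤ exp (- t ^ 2 / (2 σ ^ 2))` for every `t > 0`. -/
def SubGaussian (σ : ℝ) (p : ProbabilityMeasure ℝ) : Prop :=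
  Integrable (fun x : ℝ => x) (p : Measure ℝ) ∧
    ∀ t : ℝ, 0 < t →
      (p : Measure ℝ).real {x : ℝ | t < x - ∫ y, y ∂(p : Measure ℝ)} ≤
        Real.exp (-(t ^ 2 / (2 * σ ^ 2)))

/-- The models with `σ`-sub-Gaussian arms whose means lie in `[0, B]`. -/
def modelClass (σ B : ℝ) : Set Model :=
  {ν | ∀ a, SubGaussian σ (ν a) ∧ ν.mean a ∈ Set.Icc 0 B}

/-- The models of the class whose two means differ by `Δ`; which of the two arms is the better one
is not prescribed. -/
def gapClass (σ B Δ : ℝ) : Set Model :=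
  {ν | ν ∈ modelClass σ B ∧ |ν.mean 0 - ν.mean 1| = Δ}

/-- What the learner may do in a round: pull an arm, or terminate and recommend an arm. -/
inductive Decision where
  | pull (a : Fin 2)
  | recommend (a : Fin 2)

instance : MeasurableSpace Decision := ⊤

/-- Record of one round: the decision and the reward that was observed. -/
abbrev Round := Decision × ℝ

/-- A (possibly randomised) policy: the law of the decision in round `0`, and the conditional law
of the decision in round `n + 1` given the records of the rounds `0, …, n`. -/
structure Policy where
  first : ProbabilityMeasure Decision
  next : (n : ℕ) → Kernel ((i : Finset.Iic n) → Round) Decision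
  next_markov : ∀ n, IsMarkovKernel (next n)

instance (π : Policy) (n : ℕ) : IsMarkovKernel (π.next n) := π.next_markov n

/-- Law of the reward observed after a decision: `ν a` if arm `a` is pulled; if no arm is pulled
there is no reward, and `0` is recorded. -/
def feedback (ν : Model) : Kernel Decision ℝ where
  toFun d := match d with
    | Decision.pull a => (ν a : Measure ℝ)
    | Decision.recommend _ => Measure.dirac 0
  measurable' := measurable_from_top

instance (ν : Model) : IsMarkovKernel (feedback ν) where
  isProbabilityMeasure d := by
    cases d with
    | pull a => exact inferInstanceAs (IsProbabilityMeasure (ν a : Measure ℝ))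
    | recommend a => exact inferInstanceAs (IsProbabilityMeasure (Measure.dirac (0 : ℝ)))

/-- Conditional law of the record of round `n + 1` given the records of the rounds `0, …, n`. -/
def roundKernel (π : Policy) (ν : Model) (n : ℕ) :
    Kernel ((i : Finset.Iic n) → Round) Round :=
  (π.next n).compProd (Kernel.prodMkLeft _ (feedback ν))

instance (π : Policy) (ν : Model) (n : ℕ) : IsMarkovKernel (roundKernel π ν n) := by
  unfold roundKernel; infer_instance

/-- Joint law of the records of all rounds when `π` interacts with `ν`. For convenience the rounds
after termination are simulated too; nothing below depends on them. -/
def law (π : Policy) (ν : Model) : Measure (ℕ → Round) :=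
  Kernel.trajMeasure (X := fun _ => Round)
    ((π.first : Measure Decision).compProd (feedback ν)) (roundKernel π ν)

/-- The learner terminates in round `n`, recommending arm `a`. -/
def StopsAt (ω : ℕ → Round) (n : ℕ) (a : Fin 2) : Prop :=
  (ω n).1 = Decision.recommend a ∧ ∀ m < n, ∃ b, (ω m).1 = Decision.pull b

/-- Total number of pulls (`∞` if the learner never terminates). Rounds are numbered from `0` and
there is exactly one pull in each round before termination. -/
def numPulls (ω : ℕ → Round) : ℝ≥0∞ :=
  ⨅ (n : ℕ) (_ : ∃ a, StopsAt ω n a), (n : ℝ≥0∞)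

open Classical in
/-- The recommended arm (an irrelevant default if the learner never terminates, in which case the
sampling cost is infinite). -/
def recommended (ω : ℕ → Round) : Fin 2 :=
  if h : ∃ a n, StopsAt ω n a then h.choose else 0

/-- The simple-regret risk `E [(μ_max - μ_Î) + c τ]`, with values in `[0, ∞]`. -/
def risk (c : ℝ) (π : Policy) (ν : Model) : ℝ≥0∞ :=
  ∫⁻ ω, (ENNReal.ofReal (ν.bestMean - ν.mean (recommended ω))
    + ENNReal.ofReal c * numPulls ω) ∂(law π ν)

/-- The gap-dependent lower bound. -/
def hardness (σ c Δ : ℝ) : ℝ :=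
  if (σ ^ 2 * c) ^ ((1 : ℝ) / 3) ≤ Δ then
    σ ^ 2 * c / (4 * Δ ^ 2) * Real.log (Real.exp 1 * Δ ^ 3 / (σ ^ 2 * c))
  else Δ / 4

/-- The minimax lower bound. -/
def minimaxHardness (σ c : ℝ) : ℝ :=
  3 / 8 * (σ ^ 2 * c / Real.exp 1) ^ ((1 : ℝ) / 3)

end Bandit

end

noncomputable section

namespace Bandit

/-! Two-point argument with the Gaussian models `(Δ, 0)` and `(0, Δ)` of variance `σ ^ 2`. Swapping
the means makes the log-likelihood ratio of a pull have the same law under the first model for both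
arms, with mean `-Δ² / (2σ²)`. Hence, however the arms are chosen, Wald's identity gives the total
log-likelihood ratio mean `-T Δ² / (2σ²)`, where `T` is the expected number of pulls under the first
model (`integrable_pullSum_and_integral`).

A Bretagnolle–Huber inequality (`exp_neg_le_error_add_error`) then bounds the sum of the two error
probabilities below by `exp (-T Δ² / (2σ²)) / 2`. An error costs `Δ`, so averaging the two risks and
keeping the sampling cost of the first model only gives at least `Δ/4 · exp (-T Δ² / (2σ²)) + c T /
2`. Minimising over `T ≥ 0` yields the gap-dependent bound (`hardness_le`); evaluating it at the
worst gap yields the minimax bound (`hardness_critical`). -/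

instance : DiscreteMeasurableSpace Decision := ⟨fun _ => trivial⟩

instance : Countable Decision := by
  let f : Decision → Fin 2 ⊕ Fin 2 := fun d => match d with
    | .pull a => .inl a
    | .recommend a => .inr a
  refine Function.Injective.countable (f := f) ?_
  rintro (a | a) (b | b) h <;> simp_all [f]

instance (π : Policy) (ν : Model) : IsProbabilityMeasure (law π ν) := by
  unfold law; infer_instance

/-! ### Disintegration of the law and change of measure -/

theorem lintegral_law_zero (π : Policy) (ν : Model) {F : Round → ℝ≥0∞} (hF : Measurable F) :
    ∫⁻ ω, F (ω 0) ∂law π ν =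
      ∫⁻ d, ∫⁻ x, F (d, x) ∂feedback ν d ∂(π.first : Measure Decision) := by
  have hm : (law π ν).map (fun ω => ω 0) =
      (π.first : Measure Decision).compProd (feedback ν) := by
    have h : (fun ω : ℕ → Round => ω 0) =
        (fun h : (i : Finset.Iic 0) → Round => h ⟨0, Finset.mem_Iic.2 le_rfl⟩) ∘
          Preorder.frestrictLe (π := fun _ => Round) 0 := rfl
    rw [h, ← Measure.map_map (by fun_prop) (by fun_prop), law, Kernel.trajMeasure,
      Measure.map_comp _ _ (by fun_prop), Kernel.traj_map_frestrictLe, Kernel.partialTraj_self,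
      Measure.id_comp, Measure.map_map (by fun_prop) (by fun_prop)]
    exact Measure.map_id
  rw [← lintegral_map hF (measurable_pi_apply 0), hm, Measure.lintegral_compProd hF]

theorem measurable_lintegral_round (π : Policy) (ν : Model) (n : ℕ)
    {F : ((i : Finset.Iic n) → Round) × Round → ℝ≥0∞} (hF : Measurable F) :
    Measurable fun h : (i : Finset.Iic n) → Round =>
      ∫⁻ d, ∫⁻ x, F (h, (d, x)) ∂feedback ν d ∂π.next n h := by
  have h : Measurable fun p : ((i : Finset.Iic n) → Round) × Decision =>
      ∫⁻ x, F (p.1, (p.2, x)) ∂feedback ν p.2 :=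
    Measurable.lintegral_kernel_prod_right' (κ := Kernel.prodMkLeft _ (feedback ν))
      (f := fun q : (((i : Finset.Iic n) → Round) × Decision) × ℝ =>
        F (q.1.1, (q.1.2, q.2))) (hF.comp (by fun_prop))
  exact h.lintegral_kernel_prod_right'

theorem lintegral_law_succ (π : Policy) (ν : Model) (n : ℕ)
    {F : ((i : Finset.Iic n) → Round) × Round → ℝ≥0∞} (hF : Measurable F) :
    ∫⁻ ω, F (Preorder.frestrictLe n ω, ω (n + 1)) ∂law π ν =
      ∫⁻ ω, ∫⁻ d, ∫⁻ x, F (Preorder.frestrictLe n ω, (d, x)) ∂feedback ν d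
        ∂π.next n (Preorder.frestrictLe n ω) ∂law π ν := by
  have hm : (law π ν).map (fun ω => (Preorder.frestrictLe n ω, ω (n + 1))) =
      ((law π ν).map (Preorder.frestrictLe n)).compProd (roundKernel π ν n) :=
    Kernel.map_frestrictLe_trajMeasure_compProd_eq_map_trajMeasure.symm
  rw [← lintegral_map hF (by fun_prop), hm, Measure.lintegral_compProd hF,
    ← lintegral_map (measurable_lintegral_round π ν n hF) (by fun_prop)]
  refine lintegral_congr fun h => ?_
  rw [roundKernel, Kernel.lintegral_compProd _ _ _ (by fun_prop)]
  rfl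

/-- Weights `w` that turn the rewards of `ν` into those of `ν'`. -/
def IsLikelihoodRatio (ν ν' : Model) (w : Round → ℝ≥0∞) : Prop :=
  ∀ (d : Decision) (f : ℝ → ℝ≥0∞), Measurable f →
    ∫⁻ x, f x ∂feedback ν' d = ∫⁻ x, f x * w (d, x) ∂feedback ν d

/-- Split a history into its past and its last round. -/
def snoc {n : ℕ} (p : ((i : Finset.Iic n) → Round) × Round) : (i : Finset.Iic (n + 1)) → Round :=
  fun i => if h : (i : ℕ) ≤ n then p.1 ⟨i, Finset.mem_Iic.2 h⟩ else p.2

theorem measurable_snoc {n : ℕ} : Measurable (snoc (n := n)) := by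
  refine measurable_pi_lambda _ fun i => ?_
  unfold snoc
  split_ifs <;> fun_prop

theorem snoc_frestrictLe (n : ℕ) (ω : ℕ → Round) :
    snoc (Preorder.frestrictLe (π := fun _ => Round) n ω, ω (n + 1)) =
      Preorder.frestrictLe (n + 1) ω := by
  funext i
  have hi := Finset.mem_Iic.1 i.2
  unfold snoc
  split_ifs with h
  · rfl
  · have : (i : ℕ) = n + 1 := by omega
    simp [this]

/-- Both laws use the same decision kernels, so the policy cancels and only the reward weights
remain. -/
theorem lintegral_law_change {ν ν' : Model} {w : Round → ℝ≥0∞} (hw : Measurable w)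
    (hνν' : IsLikelihoodRatio ν ν' w) (π : Policy) (n : ℕ)
    {f : ((i : Finset.Iic n) → Round) → ℝ≥0∞} (hf : Measurable f) :
    ∫⁻ ω, f (Preorder.frestrictLe n ω) ∂law π ν' =
      ∫⁻ ω, f (Preorder.frestrictLe n ω) * ∏ i ∈ Finset.range (n + 1), w (ω i) ∂law π ν := by
  induction n with
  | zero =>
    have key : ∀ ω : ℕ → Round, Preorder.frestrictLe (π := fun _ => Round) 0 ω =
        (fun r : Round => fun _ : Finset.Iic 0 => r) (ω 0) := by
      intro ω; funext i
      have : (i : ℕ) = 0 := Nat.le_zero.1 (Finset.mem_Iic.1 i.2)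
      simp [this]
    simp_rw [key]
    have h1 : Measurable fun r : Round => f (fun _ => r) :=
      hf.comp (measurable_pi_lambda _ fun _ => measurable_id)
    rw [lintegral_law_zero π ν' h1]
    simp only [zero_add, Finset.range_one, Finset.prod_singleton]
    rw [lintegral_law_zero π ν (F := fun r => f (fun _ => r) * w r) (h1.mul hw)]
    exact lintegral_congr fun d => hνν' d _ (h1.comp measurable_prodMk_left)
  | succ n ih =>
    have h1 : Measurable fun p => f (snoc (n := n) p) := hf.comp measurable_snoc
    simp_rw [← snoc_frestrictLe n]
    rw [lintegral_law_succ π ν' n h1]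
    have h2 := measurable_lintegral_round π ν' n h1
    -- The induction hypothesis is applied to the conditional expectation given the past, computed
    -- under `ν'`; only the last reward is then left to reweight.
    rw [ih h2]
    have h4 : Measurable fun h : (i : Finset.Iic n) → Round =>
        ∏ i : Finset.Iic n, w (h i) :=
      Finset.measurable_prod _ fun i _ => hw.comp (measurable_pi_apply i)
    have hprod : ∀ ω : ℕ → Round, ∏ i ∈ Finset.range (n + 1), w (ω i) =
        ∏ i : Finset.Iic n, w (Preorder.frestrictLe (π := fun _ => Round) n ω i) := by
      intro ω
      refine Eq.trans ?_ (Finset.prod_coe_sort (Finset.Iic n) fun i => w (ω i)).symm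
      exact Finset.prod_congr (by ext; simp) fun _ _ => rfl
    simp_rw [Finset.prod_range_succ _ (n + 1), hprod]
    rw [lintegral_law_succ π ν n (F := fun p => f (snoc p) * ((∏ i : Finset.Iic n, w (p.1 i)) *
      w p.2)) (h1.mul ((h4.comp measurable_fst).mul (hw.comp measurable_snd)))]
    refine lintegral_congr fun ω => ?_
    rw [← lintegral_mul_const _ Measurable.of_discrete]
    refine lintegral_congr fun d => ?_
    have h5 : Measurable fun x : ℝ =>
        f (snoc (Preorder.frestrictLe (π := fun _ => Round) n ω, (d, x))) :=
      h1.comp (by fun_prop)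
    have h6 : Measurable fun x : ℝ =>
        f (snoc (Preorder.frestrictLe (π := fun _ => Round) n ω, (d, x))) * w (d, x) :=
      h5.mul (hw.comp measurable_prodMk_left)
    rw [hνν' d _ h5, ← lintegral_mul_const _ h6]
    exact lintegral_congr fun x => by ring

/-! ### The Gaussian pair and its log-likelihood ratio -/

/-- Gaussian arms with means `m₀`, `m₁` and variance `σ ^ 2`. -/
def gaussianModel (σ m₀ m₁ : ℝ) : Model :=
  ![⟨gaussianReal m₀ (σ ^ 2).toNNReal, inferInstance⟩,
    ⟨gaussianReal m₁ (σ ^ 2).toNNReal, inferInstance⟩]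

theorem subGaussian_gaussianReal {σ : ℝ} (hσ : 0 < σ) (m : ℝ) :
    SubGaussian σ ⟨gaussianReal m (σ ^ 2).toNNReal, inferInstance⟩ := by
  have hc : (((σ ^ 2).toNNReal : NNReal) : ℝ) = σ ^ 2 := Real.coe_toNNReal _ (by positivity)
  refine ⟨(memLp_id_gaussianReal 1).integrable le_rfl, fun t ht => ?_⟩
  simp only [ProbabilityMeasure.coe_mk, integral_id_gaussianReal]
  have hmap : (gaussianReal m (σ ^ 2).toNNReal).map (fun x => x - m) =
      gaussianReal 0 (σ ^ 2).toNNReal := by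
    rw [gaussianReal_map_sub_const, sub_self]
  have hsub : HasSubgaussianMGF (fun x : ℝ => x - m) (σ ^ 2).toNNReal
      (gaussianReal m (σ ^ 2).toNNReal) := by
    refine ⟨fun s => ?_, fun s => ?_⟩
    · have h := (integrable_exp_mul_gaussianReal (μ := m) (v := (σ ^ 2).toNNReal) s).mul_const
        (Real.exp (-(s * m)))
      refine h.congr (ae_of_all _ fun x => ?_)
      simp only [← Real.exp_add]
      ring_nf
    · rw [mgf_gaussianReal hmap]
      simp
  calc _ ≤ (gaussianReal m (σ ^ 2).toNNReal).real {x | t ≤ x - m} :=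
        measureReal_mono fun x (hx : t < x - m) => hx.le
    _ ≤ _ := (hsub.measure_ge_le ht.le).trans_eq (by rw [hc, neg_div])

@[simp] theorem gaussianModel_mean_zero (σ m₀ m₁ : ℝ) : (gaussianModel σ m₀ m₁).mean 0 = m₀ :=
  integral_id_gaussianReal

@[simp] theorem gaussianModel_mean_one (σ m₀ m₁ : ℝ) : (gaussianModel σ m₀ m₁).mean 1 = m₁ :=
  integral_id_gaussianReal

theorem gaussianModel_mem_modelClass {σ B m₀ m₁ : ℝ} (hσ : 0 < σ) (h₀ : m₀ ∈ Set.Icc 0 B)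
    (h₁ : m₁ ∈ Set.Icc 0 B) : gaussianModel σ m₀ m₁ ∈ modelClass σ B := by
  intro a
  fin_cases a
  · exact ⟨subGaussian_gaussianReal hσ m₀, (gaussianModel_mean_zero σ m₀ m₁).symm ▸ h₀⟩
  · exact ⟨subGaussian_gaussianReal hσ m₁, (gaussianModel_mean_one σ m₀ m₁).symm ▸ h₁⟩

/-- Log-likelihood ratio of a round between the Gaussian models with means `(0, Δ)` and `(Δ, 0)`. -/
def logRatio (σ Δ : ℝ) (r : Round) : ℝ :=
  match r.1 with
  | .pull a => (if a = 0 then 1 else -1) * ((Δ ^ 2 - 2 * Δ * r.2) / (2 * σ ^ 2))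
  | .recommend _ => 0

theorem measurable_logRatio (σ Δ : ℝ) : Measurable (logRatio σ Δ) := by
  refine measurable_from_prod_countable_right fun d => ?_
  cases d with
  | pull a => simp only [logRatio]; fun_prop
  | recommend a => simp only [logRatio]; fun_prop

theorem lintegral_gaussianReal_change {σ : ℝ} (hσ : 0 < σ) (m m' : ℝ) {f : ℝ → ℝ≥0∞}
    (hf : Measurable f) :
    ∫⁻ x, f x ∂gaussianReal m' (σ ^ 2).toNNReal =
      ∫⁻ x, f x * ENNReal.ofReal (Real.exp (((x - m) ^ 2 - (x - m') ^ 2) / (2 * σ ^ 2)))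
        ∂gaussianReal m (σ ^ 2).toNNReal := by
  have hv : (σ ^ 2).toNNReal ≠ 0 := by simpa using hσ.ne'
  have hc : (((σ ^ 2).toNNReal : NNReal) : ℝ) = σ ^ 2 := Real.coe_toNNReal _ (by positivity)
  rw [gaussianReal_of_var_ne_zero _ hv, gaussianReal_of_var_ne_zero _ hv,
    lintegral_withDensity_eq_lintegral_mul _ (measurable_gaussianPDF _ _) hf,
    lintegral_withDensity_eq_lintegral_mul _ (measurable_gaussianPDF _ _) (by fun_prop)]
  refine lintegral_congr fun x => ?_
  have h : gaussianPDF m' (σ ^ 2).toNNReal x = gaussianPDF m (σ ^ 2).toNNReal x *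
      ENNReal.ofReal (Real.exp (((x - m) ^ 2 - (x - m') ^ 2) / (2 * σ ^ 2))) := by
    rw [gaussianPDF, gaussianPDF, ← ENNReal.ofReal_mul (gaussianPDFReal_nonneg _ _ _),
      gaussianPDFReal, gaussianPDFReal, hc, mul_assoc (_⁻¹), ← Real.exp_add]
    congr 3
    ring
  simp only [Pi.mul_apply, h]
  ring

theorem isLikelihoodRatio_gaussianModel {σ : ℝ} (hσ : 0 < σ) (Δ : ℝ) :
    IsLikelihoodRatio (gaussianModel σ Δ 0) (gaussianModel σ 0 Δ)
      (fun r => ENNReal.ofReal (Real.exp (logRatio σ Δ r))) := by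
  intro d f hf
  cases d with
  | pull a =>
    fin_cases a
    · refine (lintegral_gaussianReal_change hσ Δ 0 hf).trans (lintegral_congr fun x => ?_)
      simp only [logRatio]
      congr 3
      simp
      ring
    · refine (lintegral_gaussianReal_change hσ 0 Δ hf).trans (lintegral_congr fun x => ?_)
      simp only [logRatio]
      congr 3
      simp
      ring
  | recommend a => simp [logRatio, feedback]

/-- The log-ratio is affine in the reward, with opposite slopes for the two arms; the swapped means
make the image laws agree. Independence of `a` is what lets Wald's identity ignore the sampling
strategy. -/
theorem map_logRatio_feedback {σ : ℝ} (hσ : 0 < σ) (Δ : ℝ) (a : Fin 2) :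
    (feedback (gaussianModel σ Δ 0) (.pull a)).map (fun x => logRatio σ Δ (.pull a, x)) =
      gaussianReal (-(Δ ^ 2 / (2 * σ ^ 2))) (Δ ^ 2 / σ ^ 2).toNNReal := by
  have aff : ∀ m u b : ℝ, (gaussianReal m (σ ^ 2).toNNReal).map (fun x => b + u * x) =
      gaussianReal (u * m + b) (u ^ 2 * σ ^ 2).toNNReal := by
    intro m u b
    have : (fun x : ℝ => b + u * x) = (fun x => b + x) ∘ (fun x => u * x) := rfl
    rw [this, ← Measure.map_map (by fun_prop) (by fun_prop), gaussianReal_map_const_mul,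
      gaussianReal_map_const_add]
    congr 1
    ext
    simp only [NNReal.coe_mul, NNReal.coe_mk]
    rw [Real.coe_toNNReal _ (by positivity), Real.coe_toNNReal _ (by positivity)]
  have hσ0 := hσ.ne'
  fin_cases a
  · have h := aff Δ (-(Δ / σ ^ 2)) (Δ ^ 2 / (2 * σ ^ 2))
    rw [show -(Δ / σ ^ 2) * Δ + Δ ^ 2 / (2 * σ ^ 2) = -(Δ ^ 2 / (2 * σ ^ 2)) by field_simp; ring,
      show (-(Δ / σ ^ 2)) ^ 2 * σ ^ 2 = Δ ^ 2 / σ ^ 2 by field_simp] at h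
    rw [← h]
    refine congrArg (fun f => Measure.map f (gaussianReal Δ (σ ^ 2).toNNReal)) (funext fun x => ?_)
    simp [logRatio]
    field_simp
    ring
  · have h := aff 0 (Δ / σ ^ 2) (-(Δ ^ 2 / (2 * σ ^ 2)))
    rw [show Δ / σ ^ 2 * 0 + -(Δ ^ 2 / (2 * σ ^ 2)) = -(Δ ^ 2 / (2 * σ ^ 2)) by ring,
      show (Δ / σ ^ 2) ^ 2 * σ ^ 2 = Δ ^ 2 / σ ^ 2 by field_simp] at h
    rw [← h]
    refine congrArg (fun f => Measure.map f (gaussianReal 0 (σ ^ 2).toNNReal)) (funext fun x => ?_)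
    simp [logRatio]
    field_simp
    ring

/-! ### Termination, number of pulls and recommendation -/

/-- The learner pulls an arm in each of the rounds `0, …, n`. -/
def Alive (ω : ℕ → Round) (n : ℕ) : Prop := ∀ m ≤ n, ∃ b, (ω m).1 = Decision.pull b

/-- The rounds in which an arm is pulled. -/
def pullRounds : Set Round := {r | ∃ b, r.1 = Decision.pull b}

theorem measurableSet_pullRounds : MeasurableSet pullRounds :=
  measurable_fst (MeasurableSet.of_discrete (s := {d : Decision | ∃ b, d = Decision.pull b}))

/-- The histories up to round `n` in which an arm is pulled in every round. -/
def aliveHistories (n : ℕ) : Set ((i : Finset.Iic n) → Round) := {h | ∀ i, h i ∈ pullRounds}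

theorem measurableSet_aliveHistories (n : ℕ) : MeasurableSet (aliveHistories n) := by
  have : aliveHistories n = ⋂ i, (fun h => h i) ⁻¹' pullRounds := by
    ext; simp [aliveHistories]
  rw [this]
  exact MeasurableSet.iInter fun i => measurable_pi_apply i measurableSet_pullRounds

theorem frestrictLe_mem_aliveHistories {n : ℕ} {ω : ℕ → Round} :
    Preorder.frestrictLe (π := fun _ => Round) n ω ∈ aliveHistories n ↔ Alive ω n :=
  ⟨fun h m hm => h ⟨m, Finset.mem_Iic.2 hm⟩, fun h i => h i (Finset.mem_Iic.1 i.2)⟩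

theorem measurableSet_alive (n : ℕ) : MeasurableSet {ω | Alive ω n} := by
  have : {ω | Alive ω n} = Preorder.frestrictLe (π := fun _ => Round) n ⁻¹' aliveHistories n := by
    ext; exact frestrictLe_mem_aliveHistories.symm
  rw [this]
  exact Preorder.measurable_frestrictLe n (measurableSet_aliveHistories n)

theorem alive_zero {ω : ℕ → Round} : Alive ω 0 ↔ ω 0 ∈ pullRounds :=
  ⟨fun h => h 0 le_rfl, fun h _ hm => Nat.le_zero.1 hm ▸ h⟩

theorem alive_succ {ω : ℕ → Round} {n : ℕ} :
    Alive ω (n + 1) ↔ Alive ω n ∧ ω (n + 1) ∈ pullRounds := by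
  refine ⟨fun h => ⟨fun m hm => h m (by omega), h _ le_rfl⟩, fun h m hm => ?_⟩
  rcases Nat.le_succ_iff.1 hm with hm | rfl
  · exact h.1 m hm
  · exact h.2

theorem StopsAt.alive_iff {ω : ℕ → Round} {n : ℕ} {a : Fin 2} (h : StopsAt ω n a) (k : ℕ) :
    Alive ω k ↔ k < n := by
  refine ⟨fun hk => ?_, fun hk m hm => h.2 m (by omega)⟩
  by_contra! hnk
  obtain ⟨b, hb⟩ := hk n hnk
  simp [h.1] at hb

theorem StopsAt.unique {ω : ℕ → Round} {m n : ℕ} {a b : Fin 2} (h : StopsAt ω m a)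
    (h' : StopsAt ω n b) : m = n ∧ a = b := by
  have hmn : m = n := by
    have h1 := (h.alive_iff n).symm.trans (h'.alive_iff n)
    have h2 := (h.alive_iff m).symm.trans (h'.alive_iff m)
    omega
  subst hmn
  exact ⟨rfl, by simpa [h.1] using h'.1⟩

theorem StopsAt.recommended_eq {ω : ℕ → Round} {n : ℕ} {a : Fin 2} (h : StopsAt ω n a) :
    recommended ω = a := by
  have hex : ∃ a n, StopsAt ω n a := ⟨a, n, h⟩
  rw [recommended, dif_pos hex]
  obtain ⟨n', h'⟩ := hex.choose_spec
  exact (h'.unique h).2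

theorem alive_of_forall_not_stopsAt {ω : ℕ → Round} (h : ∀ n a, ¬ StopsAt ω n a) (k : ℕ) :
    Alive ω k := by
  intro m
  induction m using Nat.strong_induction_on with
  | _ m ih =>
    intro hm
    cases hd : (ω m).1 with
    | pull b => exact ⟨b, rfl⟩
    | recommend a => exact absurd ⟨hd, fun j hj => ih j hj (by omega)⟩ (h m a)

/-- With rounds numbered from `0`, being alive at `k` means `τ > k`, so this is `τ = ∑ 1{τ > k}`,
valid also for `τ = ∞`. -/
theorem numPulls_eq_tsum (ω : ℕ → Round) :
    numPulls ω = ∑' k, {ω | Alive ω k}.indicator (1 : (ℕ → Round) → ℝ≥0∞) ω := by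
  by_cases h : ∃ n a, StopsAt ω n a
  · obtain ⟨n, a, h⟩ := h
    have h1 : numPulls ω = n := by
      refine le_antisymm (iInf₂_le n ⟨a, h⟩) (le_iInf₂ fun m ⟨b, hb⟩ => ?_)
      rw [(h.unique hb).1]
    rw [h1, tsum_eq_sum (s := Finset.range n) fun k hk => ?_]
    · rw [Finset.sum_congr rfl fun k hk => Set.indicator_of_mem
        (s := {ω | Alive ω k}) ((h.alive_iff k).2 (Finset.mem_range.1 hk)) _]
      simp
    · exact Set.indicator_of_notMem (fun hk' => hk (Finset.mem_range.2 ((h.alive_iff k).1 hk'))) _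
  · push Not at h
    have h1 : numPulls ω = ⊤ := by simp [numPulls, h]
    rw [h1]
    have h2 : ∀ k, {ω | Alive ω k}.indicator (1 : (ℕ → Round) → ℝ≥0∞) ω = 1 := fun k =>
      Set.indicator_of_mem (s := {ω | Alive ω k}) (alive_of_forall_not_stopsAt h k) _
    simp [h2]

theorem lintegral_numPulls (μ : Measure (ℕ → Round)) :
    ∫⁻ ω, numPulls ω ∂μ = ∑' k, μ {ω | Alive ω k} := by
  simp_rw [numPulls_eq_tsum]
  rw [lintegral_tsum fun k => (measurable_one.indicator (measurableSet_alive k)).aemeasurable]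
  exact tsum_congr fun k => lintegral_indicator_one (measurableSet_alive k)

theorem measurable_numPulls : Measurable numPulls := by
  simp_rw [funext numPulls_eq_tsum]
  exact Measurable.tsum fun k => measurable_one.indicator (measurableSet_alive k)

/-- The histories up to round `n` that terminate in round `n` and recommend `a`. -/
def stopHistories (n : ℕ) (a : Fin 2) : Set ((i : Finset.Iic n) → Round) :=
  {h | (h ⟨n, Finset.mem_Iic.2 le_rfl⟩).1 = Decision.recommend a ∧
    ∀ i : Finset.Iic n, (i : ℕ) < n → h i ∈ pullRounds}

theorem measurableSet_stopHistories (n : ℕ) (a : Fin 2) : MeasurableSet (stopHistories n a) := by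
  have : stopHistories n a =
      (fun h => (h ⟨n, Finset.mem_Iic.2 le_rfl⟩).1) ⁻¹' {Decision.recommend a} ∩
        ⋂ i : Finset.Iic n, ⋂ _ : (i : ℕ) < n, (fun h => h i) ⁻¹' pullRounds := by
    ext; simp [stopHistories]
  rw [this]
  refine MeasurableSet.inter ?_ ?_
  · exact (measurable_fst.comp (measurable_pi_apply _))
      (MeasurableSet.of_discrete (s := {Decision.recommend a}))
  · exact MeasurableSet.iInter fun i => MeasurableSet.iInter fun _ =>
      measurable_pi_apply i measurableSet_pullRounds

theorem frestrictLe_mem_stopHistories {n : ℕ} {a : Fin 2} {ω : ℕ → Round} :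
    Preorder.frestrictLe (π := fun _ => Round) n ω ∈ stopHistories n a ↔ StopsAt ω n a :=
  and_congr Iff.rfl ⟨fun h m hm => h ⟨m, Finset.mem_Iic.2 hm.le⟩ hm, fun h i hi => h i hi⟩

theorem measurableSet_stopsAt (n : ℕ) (a : Fin 2) : MeasurableSet {ω | StopsAt ω n a} := by
  have : {ω | StopsAt ω n a} =
      Preorder.frestrictLe (π := fun _ => Round) n ⁻¹' stopHistories n a := by
    ext; exact frestrictLe_mem_stopHistories.symm
  rw [this]
  exact Preorder.measurable_frestrictLe n (measurableSet_stopHistories n a)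

/-- The learner terminates and recommends arm `a`. -/
def recommendEvent (a : Fin 2) : Set (ℕ → Round) := ⋃ n, {ω | StopsAt ω n a}

theorem measurableSet_recommendEvent (a : Fin 2) : MeasurableSet (recommendEvent a) :=
  MeasurableSet.iUnion fun n => measurableSet_stopsAt n a

theorem pairwise_disjoint_stopsAt (a : Fin 2) :
    Pairwise (Function.onFun Disjoint fun n => {ω | StopsAt ω n a}) := fun _ _ hmn =>
  Set.disjoint_left.2 fun _ h h' => hmn (StopsAt.unique h h').1

theorem disjoint_recommendEvent : Disjoint (recommendEvent 0) (recommendEvent 1) := by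
  refine Set.disjoint_left.2 fun ω h h' => ?_
  obtain ⟨m, h⟩ := Set.mem_iUnion.1 h
  obtain ⟨n, h'⟩ := Set.mem_iUnion.1 h'
  exact absurd (StopsAt.unique h h').2 (by decide)

theorem ae_mem_recommendEvent {μ : Measure (ℕ → Round)} (h : ∫⁻ ω, numPulls ω ∂μ ≠ ∞) :
    ∀ᵐ ω ∂μ, ω ∈ recommendEvent 0 ∪ recommendEvent 1 := by
  filter_upwards [ae_lt_top measurable_numPulls h] with ω hω
  by_contra hnever
  have : ∀ n a, ¬ StopsAt ω n a := by
    intro n a hn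
    apply hnever
    fin_cases a
    · exact Or.inl (Set.mem_iUnion.2 ⟨n, hn⟩)
    · exact Or.inr (Set.mem_iUnion.2 ⟨n, hn⟩)
  simp [numPulls, this] at hω

/-! ### The stopped log-likelihood ratio and Wald's identity -/

/-- Cumulative value of `g` over the rounds before termination. -/
def pullSum (g : Round → ℝ) (ω : ℕ → Round) : ℝ :=
  ∑' k, {ω | Alive ω k}.indicator (fun ω => g (ω k)) ω

theorem StopsAt.hasSum_pullSum {ω : ℕ → Round} {n : ℕ} {a : Fin 2} (h : StopsAt ω n a)
    (g : Round → ℝ) :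
    HasSum (fun k => {ω | Alive ω k}.indicator (fun ω => g (ω k)) ω)
      (∑ k ∈ Finset.range n, g (ω k)) := by
  rw [← Finset.sum_congr rfl fun k hk => Set.indicator_of_mem
    (s := {ω | Alive ω k}) ((h.alive_iff k).2 (Finset.mem_range.1 hk)) (fun ω => g (ω k))]
  exact hasSum_sum_of_ne_finset_zero fun k hk => Set.indicator_of_notMem
    (fun hk' => hk (Finset.mem_range.2 ((h.alive_iff k).1 hk'))) _

theorem StopsAt.pullSum_eq {ω : ℕ → Round} {n : ℕ} {a : Fin 2} (h : StopsAt ω n a)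
    (g : Round → ℝ) : pullSum g ω = ∑ k ∈ Finset.range n, g (ω k) :=
  (h.hasSum_pullSum g).tsum_eq

/-- Change of measure at a random time: decompose by the termination round, where the finite-horizon
formula applies. No termination assumption is needed, since the event itself forces termination. -/
theorem law_recommendEvent_change {ν ν' : Model} {g : Round → ℝ} (hg : Measurable g)
    (hg0 : ∀ a x, g (.recommend a, x) = 0)
    (hνν' : IsLikelihoodRatio ν ν' fun r => ENNReal.ofReal (Real.exp (g r)))
    (π : Policy) (a : Fin 2) :
    law π ν' (recommendEvent a) =
      ∫⁻ ω in recommendEvent a, ENNReal.ofReal (Real.exp (pullSum g ω)) ∂law π ν := by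
  have key : ∀ n, law π ν' {ω | StopsAt ω n a} =
      ∫⁻ ω in {ω | StopsAt ω n a}, ENNReal.ofReal (Real.exp (pullSum g ω)) ∂law π ν := by
    intro n
    have h := lintegral_law_change (by fun_prop) hνν' π n
      (f := (stopHistories n a).indicator 1)
      (measurable_one.indicator (measurableSet_stopHistories n a))
    have hind : ∀ ω : ℕ → Round, (stopHistories n a).indicator (1 : ((i : Finset.Iic n) → Round) → ℝ≥0∞)
        (Preorder.frestrictLe (π := fun _ => Round) n ω) =
        {ω | StopsAt ω n a}.indicator 1 ω := by
      intro ω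
      by_cases hω : StopsAt ω n a <;> simp [Set.indicator, frestrictLe_mem_stopHistories, hω]
    simp_rw [hind] at h
    rw [lintegral_indicator_one (measurableSet_stopsAt n a)] at h
    rw [h, ← lintegral_indicator (measurableSet_stopsAt n a)]
    refine lintegral_congr fun ω => ?_
    by_cases hω : StopsAt ω n a
    · rw [Set.indicator_of_mem (s := {ω | StopsAt ω n a}) hω,
        Set.indicator_of_mem (s := {ω | StopsAt ω n a}) hω, Pi.one_apply, one_mul,
        hω.pullSum_eq, Finset.prod_range_succ, Real.exp_sum,
        ENNReal.ofReal_prod_of_nonneg fun i _ => (Real.exp_pos _).le]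
      -- The terminating round has weight `exp 0 = 1`, so the `n + 1` factors reduce to those of the
      -- `n` pulls.
      have : g (ω n) = 0 := by
        have := hg0 a (ω n).2
        rwa [← hω.1] at this
      simp [this]
    · rw [Set.indicator_of_notMem (s := {ω | StopsAt ω n a}) hω,
        Set.indicator_of_notMem (s := {ω | StopsAt ω n a}) hω, zero_mul]
  rw [recommendEvent, measure_iUnion (pairwise_disjoint_stopsAt a)
    fun n => measurableSet_stopsAt n a, lintegral_iUnion (fun n => measurableSet_stopsAt n a)
    (pairwise_disjoint_stopsAt a)]
  exact tsum_congr key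

/-- Given the past and the decision to pull, `g` has law `γ` whichever arm is chosen; integrating
out the last reward therefore gives a product. -/
theorem setLIntegral_alive {ν : Model} {g : Round → ℝ} (hg : Measurable g) {γ : Measure ℝ}
    [IsProbabilityMeasure γ]
    (hγ : ∀ a, (feedback ν (.pull a)).map (fun x => g (.pull a, x)) = γ) (π : Policy) (k : ℕ)
    {H : ℝ → ℝ≥0∞} (hH : Measurable H) :
    ∫⁻ ω in {ω | Alive ω k}, H (g (ω k)) ∂law π ν =
      (∫⁻ y, H y ∂γ) * law π ν {ω | Alive ω k} := by
  have hin : ∀ d, ∫⁻ x, pullRounds.indicator (fun r => H (g r)) (d, x) ∂feedback ν d =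
      ∫⁻ x, pullRounds.indicator (fun _ => ∫⁻ y, H y ∂γ) (d, x) ∂feedback ν d := by
    intro d
    cases d with
    | pull a =>
      have h1 : ∀ x : ℝ, (Decision.pull a, x) ∈ pullRounds := fun x => ⟨a, rfl⟩
      simp only [Set.indicator_of_mem (h1 _), lintegral_const, measure_univ, mul_one]
      rw [← hγ a, lintegral_map hH (by fun_prop)]
    | recommend a =>
      have h1 : ∀ x : ℝ, (Decision.recommend a, x) ∉ pullRounds := fun x ⟨b, hb⟩ => by
        simp at hb
      simp only [Set.indicator_of_notMem (h1 _)]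
  have m1 : Measurable (pullRounds.indicator fun r => H (g r)) :=
    (hH.comp hg).indicator measurableSet_pullRounds
  have m2 : Measurable (pullRounds.indicator fun _ : Round => ∫⁻ y, H y ∂γ) :=
    measurable_const.indicator measurableSet_pullRounds
  rw [← setLIntegral_const, ← lintegral_indicator (measurableSet_alive k),
    ← lintegral_indicator (measurableSet_alive k)]
  cases k with
  | zero =>
    have e : ∀ F : Round → ℝ≥0∞, (fun ω => {ω | Alive ω 0}.indicator (fun ω => F (ω 0)) ω) =
        fun ω => pullRounds.indicator F (ω 0) := by
      intro F; funext ω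
      by_cases h : ω 0 ∈ pullRounds <;> simp [Set.indicator, alive_zero, h]
    rw [e fun r => H (g r), e fun _ => ∫⁻ y, H y ∂γ, lintegral_law_zero π ν m1,
      lintegral_law_zero π ν m2]
    exact lintegral_congr hin
  | succ n =>
    have e : ∀ F : Round → ℝ≥0∞,
        (fun ω => {ω | Alive ω (n + 1)}.indicator (fun ω => F (ω (n + 1))) ω) =
        fun ω => (fun p : ((i : Finset.Iic n) → Round) × Round =>
          (aliveHistories n).indicator 1 p.1 * pullRounds.indicator F p.2)
          (Preorder.frestrictLe n ω, ω (n + 1)) := by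
      intro F; funext ω
      by_cases h1 : Alive ω n <;> by_cases h2 : ω (n + 1) ∈ pullRounds <;>
        simp [Set.indicator, alive_succ, frestrictLe_mem_aliveHistories, h1, h2]
    have m0 : Measurable ((aliveHistories n).indicator (1 : ((i : Finset.Iic n) → Round) → ℝ≥0∞)) :=
      measurable_one.indicator (measurableSet_aliveHistories n)
    have law_succ : ∀ F : Round → ℝ≥0∞, Measurable (pullRounds.indicator F) → _ :=
      fun F hF => lintegral_law_succ π ν n
        (F := fun p => (aliveHistories n).indicator 1 p.1 * pullRounds.indicator F p.2)
        ((m0.comp measurable_fst).mul (hF.comp measurable_snd))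
    rw [e fun r => H (g r), e fun _ => ∫⁻ y, H y ∂γ, law_succ _ m1, law_succ _ m2]
    refine lintegral_congr fun ω => lintegral_congr fun d => ?_
    have n1 : Measurable fun x : ℝ => pullRounds.indicator (fun r => H (g r)) (d, x) :=
      m1.comp measurable_prodMk_left
    have n2 : Measurable fun x : ℝ => pullRounds.indicator (fun _ => ∫⁻ y, H y ∂γ) (d, x) :=
      m2.comp measurable_prodMk_left
    simp only
    rw [lintegral_const_mul _ n1, lintegral_const_mul _ n2, hin]

theorem map_restrict_alive {ν : Model} {g : Round → ℝ} (hg : Measurable g) {γ : Measure ℝ}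
    [IsProbabilityMeasure γ]
    (hγ : ∀ a, (feedback ν (.pull a)).map (fun x => g (.pull a, x)) = γ) (π : Policy) (k : ℕ) :
    ((law π ν).restrict {ω | Alive ω k}).map (fun ω => g (ω k)) =
      law π ν {ω | Alive ω k} • γ := by
  refine Measure.ext_of_lintegral _ fun H hH => ?_
  rw [lintegral_map hH (by fun_prop), setLIntegral_alive hg hγ π k hH, lintegral_smul_measure,
    smul_eq_mul, mul_comm]

/-- **Wald's identity**, with the accompanying integrability. -/
theorem integrable_pullSum_and_integral {ν : Model} {g : Round → ℝ} (hg : Measurable g)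
    {γ : Measure ℝ} [IsProbabilityMeasure γ] (hint : Integrable (fun x => x) γ)
    (hγ : ∀ a, (feedback ν (.pull a)).map (fun x => g (.pull a, x)) = γ) (π : Policy)
    (hT : ∫⁻ ω, numPulls ω ∂law π ν ≠ ∞) :
    Integrable (pullSum g) (law π ν) ∧
      ∫ ω, pullSum g ω ∂law π ν = (∫⁻ ω, numPulls ω ∂law π ν).toReal * ∫ x, x ∂γ := by
  set f : ℕ → (ℕ → Round) → ℝ := fun k => {ω | Alive ω k}.indicator (fun ω => g (ω k)) with hf
  have hfm : ∀ k, Measurable (f k) := fun k =>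
    Measurable.indicator (by fun_prop) (measurableSet_alive k)
  have hnorm : ∀ k, ∫⁻ ω, ‖f k ω‖ₑ ∂law π ν = (∫⁻ y, ‖y‖ₑ ∂γ) * law π ν {ω | Alive ω k} := by
    intro k
    rw [← setLIntegral_alive hg hγ π k (H := fun y => ‖y‖ₑ) (by fun_prop),
      ← lintegral_indicator (measurableSet_alive k)]
    exact lintegral_congr fun ω => enorm_indicator_eq_indicator_enorm _ _
  -- The sum equals the first absolute moment of `γ` times the expected number of pulls; its
  -- finiteness gives integrability and the exchange of sum and expectation.
  have hsum : ∑' k, ∫⁻ ω, ‖f k ω‖ₑ ∂law π ν ≠ ∞ := by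
    simp_rw [hnorm]
    rw [ENNReal.tsum_mul_left, ← lintegral_numPulls]
    exact ENNReal.mul_ne_top hint.2.ne hT
  have hval : ∀ k, ∫ ω, f k ω ∂law π ν = (law π ν {ω | Alive ω k}).toReal * ∫ x, x ∂γ := by
    intro k
    rw [integral_indicator (measurableSet_alive k),
      ← integral_map (f := fun x : ℝ => x) (φ := fun ω : ℕ → Round => g (ω k))
        (hg.comp (measurable_pi_apply k)).aemeasurable (by fun_prop), map_restrict_alive hg hγ π k, integral_smul_measure, smul_eq_mul]
  refine ⟨⟨?_, ?_⟩, ?_⟩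
  · exact (Measurable.tsum hfm).aestronglyMeasurable
  · refine lt_of_le_of_lt (lintegral_mono fun ω => enorm_tsum_le_tsum_enorm) ?_
    rw [lintegral_tsum fun k => (hfm k).enorm.aemeasurable]
    exact hsum.lt_top
  · have : ∫ ω, pullSum g ω ∂law π ν = ∑' k, ∫ ω, f k ω ∂law π ν :=
      integral_tsum (fun k => (hfm k).aestronglyMeasurable) hsum
    simp_rw [this, hval]
    rw [tsum_mul_right, lintegral_numPulls, ENNReal.tsum_toReal_eq fun k => measure_ne_top _ _]

/-! ### Bretagnolle–Huber inequality -/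

/-- A pointwise lower bound for `min 1 (exp y)` that replaces Cauchy–Schwarz and Jensen by a single
integration. The tangent line of `exp` bounds the first term by `h * z`, and `h * z ≤ 1 + h² z² /
4`, `h * z ≤ z² + h² / 4` are completed squares. -/
theorem exp_tangent_le_one (s y : ℝ) :
    Real.exp (-s) * (1 + (y + s) / 2) - Real.exp (-s) / 4 * (1 + Real.exp y) ≤ 1 ∧
      Real.exp (-s) * (1 + (y + s) / 2) - Real.exp (-s) / 4 * (1 + Real.exp y) ≤ Real.exp y := by
  set h := Real.exp (-s / 2)
  set z := Real.exp (y / 2)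
  have hh : Real.exp (-s) = h ^ 2 := by rw [← Real.exp_nat_mul]; congr 1; push_cast; ring
  have hz : Real.exp y = z ^ 2 := by rw [← Real.exp_nat_mul]; congr 1; push_cast; ring
  have h1 : Real.exp (-s) * (1 + (y + s) / 2) ≤ h * z := by
    calc _ ≤ Real.exp (-s) * Real.exp ((y + s) / 2) := by
          gcongr
          linarith [Real.add_one_le_exp ((y + s) / 2)]
      _ = h * z := by
          rw [← Real.exp_add, ← Real.exp_add]; congr 1; ring
  rw [hz]
  rw [hh] at h1 ⊢
  constructor
  · nlinarith [sq_nonneg (h * z - 2), sq_nonneg h]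
  · nlinarith [sq_nonneg (h - 2 * z), sq_nonneg (h * z)]

/-- A Bretagnolle–Huber inequality for the recommendation of a policy that terminates. -/
theorem exp_neg_le_error_add_error {ν ν' : Model} {g : Round → ℝ} (hg : Measurable g)
    (hg0 : ∀ a x, g (.recommend a, x) = 0)
    (hνν' : IsLikelihoodRatio ν ν' fun r => ENNReal.ofReal (Real.exp (g r)))
    {γ : Measure ℝ} [IsProbabilityMeasure γ] (hint : Integrable (fun x => x) γ)
    (hγ : ∀ a, (feedback ν (.pull a)).map (fun x => g (.pull a, x)) = γ) (π : Policy)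
    (hT : ∫⁻ ω, numPulls ω ∂law π ν ≠ ∞) :
    Real.exp ((∫⁻ ω, numPulls ω ∂law π ν).toReal * ∫ x, x ∂γ) / 2 ≤
      (law π ν).real (recommendEvent 1) + (law π ν').real (recommendEvent 0) := by
  obtain ⟨hΛ, hwald⟩ := integrable_pullSum_and_integral hg hint hγ π hT
  set Λ := pullSum g
  set P := law π ν
  set P' := law π ν'
  -- By Wald's identity `s` is minus the mean of `Λ`, so `Λ + s` is centred.
  set s := -((∫⁻ ω, numPulls ω ∂P).toReal * ∫ x, x ∂γ) with hs
  have hΛm : AEMeasurable (fun ω => Real.exp (Λ ω)) P := hΛ.1.aemeasurable.exp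
  have hexp : ∀ a, IntegrableOn (fun ω => Real.exp (Λ ω)) (recommendEvent a) P ∧
      ∫ ω in recommendEvent a, Real.exp (Λ ω) ∂P = P'.real (recommendEvent a) := by
    intro a
    have h := law_recommendEvent_change hg hg0 hνν' π a
    have hi : IntegrableOn (fun ω => Real.exp (Λ ω)) (recommendEvent a) P := by
      refine ⟨hΛm.aestronglyMeasurable.restrict, ?_⟩
      rw [hasFiniteIntegral_iff_ofReal (ae_of_all _ fun ω => (Real.exp_pos _).le), ← h]
      exact measure_lt_top _ _
    refine ⟨hi, ?_⟩
    rw [integral_eq_lintegral_of_nonneg_ae (ae_of_all _ fun ω => (Real.exp_pos _).le) hi.1, ← h]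
    rfl
  have hm := measurableSet_recommendEvent
  have hone : ∀ a, Integrable ((recommendEvent a).indicator (1 : (ℕ → Round) → ℝ)) P := fun a =>
    (integrable_const (1 : ℝ)).indicator (hm a)
  have hexp' : ∀ a, Integrable ((recommendEvent a).indicator fun ω => Real.exp (Λ ω)) P := fun a =>
    (integrable_indicator_iff (hm a)).2 (hexp a).1
  have hU : ∫ ω, ((recommendEvent 1).indicator (1 : (ℕ → Round) → ℝ) ω +
      (recommendEvent 0).indicator (fun ω => Real.exp (Λ ω)) ω) ∂P =
      P.real (recommendEvent 1) + P'.real (recommendEvent 0) := by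
    rw [integral_add (hone 1) (hexp' 0), integral_indicator_one (hm 1),
      integral_indicator (hm 0), (hexp 0).2]
  have hexpSum : Integrable (fun ω => (recommendEvent 0).indicator (fun ω => Real.exp (Λ ω)) ω +
      (recommendEvent 1).indicator (fun ω => Real.exp (Λ ω)) ω) P := (hexp' 0).add (hexp' 1)
  have hVint : Integrable (fun ω => 1 + ((recommendEvent 0).indicator (fun ω => Real.exp (Λ ω)) ω +
      (recommendEvent 1).indicator (fun ω => Real.exp (Λ ω)) ω)) P :=
    (integrable_const _).add hexpSum
  -- Only an inequality, because the policy need not terminate almost surely under `ν'`.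
  have hV : ∫ ω, (1 + ((recommendEvent 0).indicator (fun ω => Real.exp (Λ ω)) ω +
      (recommendEvent 1).indicator (fun ω => Real.exp (Λ ω)) ω)) ∂P ≤ 2 := by
    rw [integral_add (integrable_const _) hexpSum,
      integral_add (hexp' 0) (hexp' 1), integral_indicator (hm 0), integral_indicator (hm 1),
      (hexp 0).2, (hexp 1).2, ← measureReal_union disjoint_recommendEvent (hm 1)]
    have : P'.real (recommendEvent 0 ∪ recommendEvent 1) ≤ 1 := measureReal_le_one
    simp only [integral_const, probReal_univ, smul_eq_mul]
    linarith
  have hhalf : Integrable (fun ω => (Λ ω + s) / 2) P :=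
    (hΛ.add (integrable_const s)).div_const 2
  have hlin : Integrable (fun ω => Real.exp (-s) * (1 + (Λ ω + s) / 2)) P :=
    ((integrable_const 1).add hhalf).const_mul _
  have hmono : ∫ ω, (Real.exp (-s) * (1 + (Λ ω + s) / 2) - Real.exp (-s) / 4 *
      (1 + ((recommendEvent 0).indicator (fun ω => Real.exp (Λ ω)) ω +
      (recommendEvent 1).indicator (fun ω => Real.exp (Λ ω)) ω))) ∂P ≤
      P.real (recommendEvent 1) + P'.real (recommendEvent 0) := by
    rw [← hU]
    refine integral_mono_ae (hlin.sub (hVint.const_mul _)) ((hone 1).add (hexp' 0)) ?_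
    -- Almost every path under `P` recommends an arm, and the error integrand there is `exp Λ` (arm
    -- `0`) or `1` (arm `1`); either dominates the tangent expression.
    filter_upwards [ae_mem_recommendEvent hT] with ω hω
    rcases hω with h | h
    · have h' := Set.disjoint_left.1 disjoint_recommendEvent h
      simpa [h, h'] using (exp_tangent_le_one s (Λ ω)).2
    · have h' := Set.disjoint_right.1 disjoint_recommendEvent h
      simpa [h, h'] using (exp_tangent_le_one s (Λ ω)).1
  have hlinval : ∫ ω, Real.exp (-s) * (1 + (Λ ω + s) / 2) ∂P = Real.exp (-s) := by
    have h1 : ∫ ω, (1 + (Λ ω + s) / 2) ∂P = 1 := by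
      rw [integral_add (integrable_const _) hhalf,
        integral_div, integral_add hΛ (integrable_const s), hwald]
      simp [hs]
    rw [integral_const_mul, h1, mul_one]
  rw [integral_sub hlin (hVint.const_mul _), integral_const_mul (Real.exp (-s) / 4),
    hlinval] at hmono
  rw [← neg_neg ((∫⁻ ω, numPulls ω ∂P).toReal * ∫ x, x ∂γ), ← hs]
  -- The left side is at least `exp (-s) - exp (-s) / 4 * 2 = exp (-s) / 2`.
  nlinarith [Real.exp_pos (-s)]

/-! ### From error probabilities to risk, and optimisation -/

theorem le_risk {c : ℝ} (π : Policy) {ν : Model} {Δ : ℝ} {a : Fin 2}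
    (hΔ : ν.bestMean - ν.mean a = Δ) :
    ENNReal.ofReal Δ * law π ν (recommendEvent a) +
      ENNReal.ofReal c * ∫⁻ ω, numPulls ω ∂law π ν ≤ risk c π ν := by
  -- Splitting the integral requires measurability of the sampling cost only, not of `recommended`.
  rw [risk, lintegral_add_right _ (measurable_numPulls.const_mul _),
    lintegral_const_mul _ measurable_numPulls, ← lintegral_indicator_const
      (measurableSet_recommendEvent a)]
  refine add_le_add_left (lintegral_mono fun ω => ?_) _
  refine Set.indicator_apply_le' (fun hω => ?_) fun _ => zero_le
  obtain ⟨n, h⟩ := Set.mem_iUnion.1 hω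
  rw [StopsAt.recommended_eq h, hΔ]

/-- In the variables `s` and `K` the right side is `Δ/4 · exp (-s) + K s`. For large gaps the cost
is weakened to `K s / 4`, whose sum with the first term is minimal at `s = log (Δ / K)`; for small
gaps `Δ ≤ K`, and `exp (-s) ≥ 1 - s` shows that `s = 0` is optimal. -/
theorem hardness_le {σ c Δ : ℝ} (hσ : 0 < σ) (hc : 0 < c) (hΔ : 0 < Δ) {t : ℝ} (ht : 0 ≤ t) :
    hardness σ c Δ ≤ Δ / 4 * Real.exp (-(t * (Δ ^ 2 / (2 * σ ^ 2)))) + c * t / 2 := by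
  have hA : 0 < σ ^ 2 * c := by positivity
  set s := t * (Δ ^ 2 / (2 * σ ^ 2)) with hs
  set K := σ ^ 2 * c / Δ ^ 2 with hK
  have hs0 : 0 ≤ s := by positivity
  have hK0 : 0 < K := by positivity
  have hcost : c * t / 2 = K * s := by
    rw [hs, hK]; field_simp
  have hcube : ((σ ^ 2 * c) ^ ((1 : ℝ) / 3)) ^ 3 = σ ^ 2 * c := by
    rw [← Real.rpow_natCast, ← Real.rpow_mul hA.le]; norm_num
  rw [hcost, hardness]
  split_ifs with h
  · set x := Δ ^ 3 / (σ ^ 2 * c) with hx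
    have hx0 : 0 < x := by positivity
    have hlog : Real.log (Real.exp 1 * Δ ^ 3 / (σ ^ 2 * c)) = 1 + Real.log x := by
      rw [mul_div_assoc, Real.log_mul (Real.exp_pos 1).ne' hx0.ne', Real.log_exp]
    have hxe : x * Real.exp (-s) = Real.exp (Real.log x - s) := by
      rw [sub_eq_add_neg, Real.exp_add, Real.exp_log hx0]
    have hΔK : Δ = K * x := by rw [hK, hx]; field_simp
    -- The tangent to `exp` at `0` is sharp at the minimiser `s = log x`.
    have h1 := Real.add_one_le_exp (Real.log x - s)
    calc _ = K / 4 * (1 + Real.log x) := by rw [hlog, hK]; field_simp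
      _ ≤ K / 4 * (Real.exp (Real.log x - s) + s) :=
        mul_le_mul_of_nonneg_left (by linarith) (by positivity)
      _ = Δ / 4 * Real.exp (-s) + K / 4 * s := by rw [← hxe, hΔK]; ring
      _ ≤ _ := by nlinarith
  · have h3 : Δ ^ 3 < σ ^ 2 * c := by
      rw [← hcube]
      exact pow_lt_pow_left₀ (not_le.1 h) hΔ.le (by norm_num)
    have hΔK : Δ ≤ K := by
      rw [hK, le_div_iff₀ (by positivity)]
      nlinarith
    have h1 := Real.add_one_le_exp (-s)
    nlinarith [mul_le_mul_of_nonneg_right hΔK hs0, mul_nonneg hK0.le hs0,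
      mul_le_mul_of_nonneg_left h1 hΔ.le]

theorem hardness_le_iSup_risk {σ c B Δ : ℝ} (hσ : 0 < σ) (hc : 0 < c) (hΔ : 0 < Δ) (hΔB : Δ ≤ B)
    (π : Policy) :
    ENNReal.ofReal (hardness σ c Δ) ≤ ⨆ ν ∈ gapClass σ B Δ, risk c π ν := by
  have hB : (0 : ℝ) ≤ B := hΔ.le.trans hΔB
  set ν := gaussianModel σ Δ 0 with hν
  set ν' := gaussianModel σ 0 Δ with hν'
  have hmem : ν ∈ gapClass σ B Δ :=
    ⟨gaussianModel_mem_modelClass hσ ⟨hΔ.le, hΔB⟩ ⟨le_rfl, hB⟩, by simp [hν, abs_of_pos hΔ]⟩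
  have hmem' : ν' ∈ gapClass σ B Δ :=
    ⟨gaussianModel_mem_modelClass hσ ⟨le_rfl, hB⟩ ⟨hΔ.le, hΔB⟩, by simp [hν', abs_of_pos hΔ]⟩
  by_contra! hlt
  have h1 := ((le_risk (c := c) π (ν := ν) (Δ := Δ) (a := 1)
    (by simp [Model.bestMean, hν, hΔ.le])).trans
    (le_iSup₂ (f := fun ν _ => risk c π ν) ν hmem)).trans_lt hlt
  have h2 := ((le_risk (c := c) π (ν := ν') (Δ := Δ) (a := 0)
    (by simp [Model.bestMean, hν', hΔ.le])).trans
    (le_iSup₂ (f := fun ν _ => risk c π ν) ν' hmem')).trans_lt hlt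
  -- An infinite expected number of pulls makes the risk infinite, as `c > 0`.
  have hT : ∫⁻ ω, numPulls ω ∂law π ν ≠ ∞ := by
    intro htop
    rw [htop, ENNReal.mul_top (by simpa using hc), add_top] at h1
    exact not_top_lt h1
  have hBH := exp_neg_le_error_add_error (measurable_logRatio σ Δ) (fun _ _ => rfl)
    (isLikelihoodRatio_gaussianModel hσ Δ) ((memLp_id_gaussianReal 1).integrable le_rfl)
    (map_logRatio_feedback hσ Δ) π hT
  rw [integral_id_gaussianReal, mul_neg] at hBH
  have hle := hardness_le hσ hc hΔ (t := (∫⁻ ω, numPulls ω ∂law π ν).toReal) ENNReal.toReal_nonneg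
  rw [← ENNReal.ofReal_toReal hT, ← ofReal_measureReal, ← ENNReal.ofReal_mul hΔ.le,
    ← ENNReal.ofReal_mul hc.le, ← ENNReal.ofReal_add (by positivity) (by positivity),
    ENNReal.ofReal_lt_ofReal_iff_of_nonneg (by positivity)] at h1
  -- The sampling cost under `ν'` is discarded; the inequality controls the expected number of pulls
  -- under `ν` only.
  have h2' := le_self_add.trans_lt h2
  rw [← ofReal_measureReal, ← ENNReal.ofReal_mul hΔ.le,
    ENNReal.ofReal_lt_ofReal_iff_of_nonneg (by positivity)] at h2'
  have h3 := mul_le_mul_of_nonneg_left hBH hΔ.le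
  rw [mul_add] at h3
  linarith

/-- This gap maximises `hardness`: with `x = Δ³ / (σ² c)`, the derivative of `Δ⁻² (1 + log x)`
vanishes at `log x = 1/2`. The logarithm is then `3/2`, which produces the factor `3/8`. -/
theorem hardness_critical {σ c : ℝ} (hσ : 0 < σ) (hc : 0 < c) :
    hardness σ c ((Real.sqrt (Real.exp 1) * σ ^ 2 * c) ^ ((1 : ℝ) / 3)) = minimaxHardness σ c := by
  have hA : 0 < σ ^ 2 * c := by positivity
  have hE : Real.sqrt (Real.exp 1) = Real.exp (1 / 2) := (Real.exp_half 1).symm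
  have hΔ : (Real.sqrt (Real.exp 1) * σ ^ 2 * c) ^ ((1 : ℝ) / 3) =
      Real.exp (1 / 6) * (σ ^ 2 * c) ^ ((1 : ℝ) / 3) := by
    rw [mul_assoc, hE, Real.mul_rpow (Real.exp_pos _).le hA.le, ← Real.exp_mul]
    norm_num
  have hle : (σ ^ 2 * c) ^ ((1 : ℝ) / 3) ≤ Real.exp (1 / 6) * (σ ^ 2 * c) ^ ((1 : ℝ) / 3) :=
    le_mul_of_one_le_left (by positivity) (Real.one_le_exp (by norm_num))
  have hcube : ((σ ^ 2 * c) ^ ((1 : ℝ) / 3)) ^ 3 = σ ^ 2 * c := by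
    rw [← Real.rpow_natCast, ← Real.rpow_mul hA.le]; norm_num
  rw [hΔ, hardness, if_pos hle, minimaxHardness, Real.div_rpow hA.le (Real.exp_pos _).le,
    ← Real.exp_mul]
  set r := (σ ^ 2 * c) ^ ((1 : ℝ) / 3)
  have hr : 0 < r := by positivity
  have h6 : Real.exp (1 / 6) ^ 3 = Real.exp (1 / 2) := by
    rw [← Real.exp_nat_mul]; norm_num
  have h3 : Real.exp (1 * (1 / 3)) = Real.exp (1 / 6) ^ 2 := by
    rw [← Real.exp_nat_mul]; norm_num
  have hlog : Real.log (Real.exp 1 * (Real.exp (1 / 6) * r) ^ 3 / (σ ^ 2 * c)) = 3 / 2 := by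
    rw [mul_pow, hcube, h6, ← mul_assoc, mul_div_assoc, div_self hA.ne', mul_one, ← Real.exp_add,
      Real.log_exp]
    norm_num
  rw [hlog, h3, ← hcube]
  field_simp
  norm_num

end Bandit

end

theorem corollary3 (σ c B : ℝ) (hσ : 0 < σ) (hc : 0 < c) :
    (∀ Δ : ℝ, 0 < Δ → Δ ≤ B → ∀ π : Bandit.Policy,
      ENNReal.ofReal (Bandit.hardness σ c Δ) ≤
        ⨆ ν ∈ Bandit.gapClass σ B Δ, Bandit.risk c π ν) ∧
    ((Real.sqrt (Real.exp 1) * σ ^ 2 * c) ^ ((1 : ℝ) / 3) ≤ B → ∀ π : Bandit.Policy,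
      ENNReal.ofReal (Bandit.minimaxHardness σ c) ≤
        ⨆ ν ∈ Bandit.modelClass σ B, Bandit.risk c π ν) := by
  refine ⟨fun Δ hΔ hΔB π => Bandit.hardness_le_iSup_risk hσ hc hΔ hΔB π, fun hB π => ?_⟩
  rw [← Bandit.hardness_critical hσ hc]
  exact (Bandit.hardness_le_iSup_risk hσ hc (by positivity) hB π).trans
    (biSup_mono fun ν hν => hν.1)
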